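/- A partially ordered group is a group $G$ with a partial order $\le$ such that $a\le b$ implies $sat\le sbt$ for all $a,b,s,t\in G$; an $\ell$-group is a partially ordered group whose order is a lattice order. An $\ell$-group is representable if it is a subdirect product of totally ordered groups. A variety of $\ell$-groups is a class of $\ell$-groups defined by equations in the language of $\ell$-groups. Let $G$ be a partially ordered group with identity $\mathrm e$ and $G^+=\{a\in G: a\ge \mathrm e\}$. A right pre-order on $G$ is a reflexive, transitive, total relation $\preceq\,\neq G\times G$ that extends $\le$ and satisfies $a\preceq b\Rightarrow at\preceq bt$. It is identified with its positive cone $C=\{a: \mathrm e\preceq a\}$ (so $a\preceq b$ iff $ba^{-1}\in C$); the sets arising in this way are exactly the proper submonoids $C\subsetneq G$ with $G^+\subseteq C$ and $G=C\cup C^{-1}$. A right pre-order is called a pre-order if it is also left-invariant, equivalently if $t^{-1}Ct\subseteq C$ for all $t\in G$. For a right pre-order $C$ let $\Omega_C$ be the chain obtained as the quotient of $G$ by the equivalence $a\preceq b\preceq a$. Let $\operatorname{Aut}(\Omega_C)$ be the $\ell$-group of its order-preserving bijections, with pointwise lattice operations and with product $fg$ standing for "$g$ after $f$", and let $H_C$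 be the $\ell$-subgroup of $\operatorname{Aut}(\Omega_C)$ generated by the maps $[b]\mapsto[ba]$, $a\in G$. For a variety $\mathsf V$ of $\ell$-groups, let $\mathcal P_{\mathsf V}(G)$ be the set of right pre-orders $C$ on $G$ with $H_C\in\mathsf V$, ordered by inclusion and endowed with the smallest topology containing all the sets $\{C: a\in C,\ a^{-1}\notin C\}$, $a\in G$. Let $\mathcal B_{\mathsf V}(G)\subseteq\mathcal P_{\mathsf V}(G)$ be the subset of pre-orders, with the subspace topology. A topological space is generalised spectral if every nonempty irreducible closed subset is the closure of a unique point and the compact open subsets form a base that is closed under (nonempty) finite intersections. **Theorem 7.9.** Let $G$ be any partially ordered group and let $\mathsf V$ be any variety of $\ell$-groups all of whose members are representable. 1. The space $\mathcal B_{\mathsf V}(G)$ is generalised spectral. 2. The assignment $\beta(C)=\bigcap_{t\in G}t^{-1}Ct$ defines a map $\beta\colon\mathcal P_{\mathsf V}(G)\to\mathcal P_{\mathsf V}(G)$ that is an interior operator (that is, $\beta(C)\subseteq C$; $C\subseteq D$ implies $\beta(C)\subseteq\beta(D)$; and $\beta\circ\beta=\beta$), and $\mathcal B_{\mathsf V}(G)$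 is exactly the set of its open elements, i.e. of the $C$ with $\beta(C)=C$. Moreover, $\beta\colon\mathcal P_{\mathsf V}(G)\to\mathcal B_{\mathsf V}(G)$ is a continuous retraction: it takes values in $\mathcal B_{\mathsf V}(G)$, is continuous, and restricts to the identity on $\mathcal B_{\mathsf V}(G)$. -/

import Mathlib

universe u v

/-! ### Lattice-ordered groups: terms, varieties, representability

An `ℓ`-group is a type with instances `Group`, `Lattice`, `MulLeftMono`, `MulRightMono`. -/

/-- Terms in the language of `ℓ`-groups, over countably many variables. -/
inductive LTerm : Type
  | var : ℕ → LTerm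
  | one : LTerm
  | mul : LTerm → LTerm → LTerm
  | inv : LTerm → LTerm
  | sup : LTerm → LTerm → LTerm
  | inf : LTerm → LTerm → LTerm

/-- The value of a term under an assignment of its variables. -/
def LTerm.eval {H : Type v} [Group H] [Lattice H] (x : ℕ → H) : LTerm → H
  | .var n => x n
  | .one => 1
  | .mul s t => s.eval x * t.eval x
  | .inv s => (s.eval x)⁻¹
  | .sup s t => s.eval x ⊔ t.eval x
  | .inf s t => s.eval x ⊓ t.eval x

/-- A variety (equationally definable class) of `ℓ`-groups, given by a set of defining
equations. -/
structure LGroupVariety : Type where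
  equations : Set (LTerm × LTerm)

/-- The `ℓ`-group `H` belongs to the variety `V`: it satisfies all defining equations. -/
def LGroupVariety.Mem (V : LGroupVariety) (H : Type v) [Group H] [Lattice H]
    [MulLeftMono H] [MulRightMono H] : Prop :=
  ∀ e ∈ V.equations, ∀ x : ℕ → H, e.1.eval x = e.2.eval x

/-- An `ℓ`-group is representable if it is a subdirect product of totally ordered groups. -/
def IsRepresentableLGroup (H : Type v) [Group H] [Lattice H]
    [MulLeftMono H] [MulRightMono H] : Prop :=
  ∃ (ι : Type v) (T : ι → Type v) (_ : ∀ i, Group (T i)) (_ : ∀ i, LinearOrder (T i))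
    (_ : ∀ i, MulLeftMono (T i)) (_ : ∀ i, MulRightMono (T i)) (φ : H →* (∀ i, T i)),
    Function.Injective φ ∧
    (∀ x y, φ (x ⊔ y) = φ x ⊔ φ y) ∧
    (∀ x y, φ (x ⊓ y) = φ x ⊓ φ y) ∧
    (∀ i, Function.Surjective fun x => φ x i)

/-- All members of `V` (in the universe at hand) are representable. -/
def LGroupVariety.IsRepresentable (V : LGroupVariety) : Prop :=
  ∀ (H : Type u) [Group H] [Lattice H] [MulLeftMono H] [MulRightMono H],
    V.Mem H → IsRepresentableLGroup H

/-! ### The `ℓ`-subgroup generated by a set -/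

/-- The `ℓ`-subgroup (sublattice subgroup) generated by a subset. -/
def lClosure {H : Type v} [Group H] [Lattice H] (S : Set H) : Subgroup H :=
  sInf {K : Subgroup H | S ⊆ K ∧ ∀ x ∈ K, ∀ y ∈ K, x ⊔ y ∈ K ∧ x ⊓ y ∈ K}

section lClosure

variable {H : Type v} [Group H] [Lattice H] {S : Set H}

theorem sup_mem_lClosure {x y : H} (hx : x ∈ lClosure S) (hy : y ∈ lClosure S) :
    x ⊔ y ∈ lClosure S :=
  Subgroup.mem_sInf.2 fun K hK =>
    (hK.2 x (Subgroup.mem_sInf.1 hx K hK) y (Subgroup.mem_sInf.1 hy K hK)).1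

theorem inf_mem_lClosure {x y : H} (hx : x ∈ lClosure S) (hy : y ∈ lClosure S) :
    x ⊓ y ∈ lClosure S :=
  Subgroup.mem_sInf.2 fun K hK =>
    (hK.2 x (Subgroup.mem_sInf.1 hx K hK) y (Subgroup.mem_sInf.1 hy K hK)).2

instance : Lattice (lClosure S) :=
  Subtype.lattice (fun _ _ hx hy => sup_mem_lClosure hx hy)
    (fun _ _ hx hy => inf_mem_lClosure hx hy)

instance [MulLeftMono H] : MulLeftMono (lClosure S) :=
  ⟨fun a _ _ h => mul_le_mul_right (α := H) h a⟩

instance [MulRightMono H] : MulRightMono (lClosure S) :=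
  ⟨fun a _ _ h => mul_le_mul_left (α := H) h a⟩

end lClosure

/-! ### The `ℓ`-group of order-automorphisms of a chain -/

/-- The order-preserving bijections of a chain, with product `f * g` standing for
"`g` after `f`" and with the pointwise order. -/
structure ChainAut (Ω : Type v) [LinearOrder Ω] where
  toOrderIso : Ω ≃o Ω

namespace ChainAut

variable {Ω : Type v} [LinearOrder Ω]

instance : CoeFun (ChainAut Ω) fun _ => Ω → Ω := ⟨fun f => f.toOrderIso⟩

@[ext] theorem ext {f g : ChainAut Ω} (h : ∀ w, f w = g w) : f = g := by
  cases f; cases g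
  congr 1
  exact OrderIso.ext (funext h)

instance : Group (ChainAut Ω) where
  mul f g := ⟨f.toOrderIso.trans g.toOrderIso⟩
  one := ⟨OrderIso.refl Ω⟩
  inv f := ⟨f.toOrderIso.symm⟩
  mul_assoc _ _ _ := rfl
  one_mul _ := rfl
  mul_one _ := rfl
  inv_mul_cancel f := ext fun w => f.toOrderIso.apply_symm_apply w

@[simp] theorem mul_apply (f g : ChainAut Ω) (w : Ω) : (f * g) w = g (f w) := rfl

@[simp] theorem one_apply (w : Ω) : (1 : ChainAut Ω) w = w := rfl

instance : PartialOrder (ChainAut Ω) where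
  le f g := ∀ w, f w ≤ g w
  le_refl _ _ := le_rfl
  le_trans _ _ _ h k w := (h w).trans (k w)
  le_antisymm _ _ h k := ext fun w => le_antisymm (h w) (k w)

/-- The pointwise supremum. -/
def supIso (f g : Ω ≃o Ω) : Ω ≃o Ω :=
  StrictMono.orderIsoOfRightInverse (fun w => f w ⊔ g w)
    (fun _ _ h => max_lt_max (f.strictMono h) (g.strictMono h))
    (fun w => f.symm w ⊓ g.symm w) (fun w => by
      rcases le_total (f.symm w) (g.symm w) with h | h
      · have : g (f.symm w) ≤ w := by simpa using g.monotone h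
        simp [h, this]
      · have : f (g.symm w) ≤ w := by simpa using f.monotone h
        simp [h, this])

/-- The pointwise infimum. -/
def infIso (f g : Ω ≃o Ω) : Ω ≃o Ω :=
  StrictMono.orderIsoOfRightInverse (fun w => f w ⊓ g w)
    (fun _ _ h => min_lt_min (f.strictMono h) (g.strictMono h))
    (fun w => f.symm w ⊔ g.symm w) (fun w => by
      rcases le_total (f.symm w) (g.symm w) with h | h
      · have : w ≤ f (g.symm w) := by simpa using f.monotone h
        simp [h, this]
      · have : w ≤ g (f.symm w) := by simpa using g.monotone h
        simp [h, this])

instance : Lattice (ChainAut Ω) where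
  sup f g := ⟨supIso f.toOrderIso g.toOrderIso⟩
  inf f g := ⟨infIso f.toOrderIso g.toOrderIso⟩
  le_sup_left _ _ _ := le_max_left _ _
  le_sup_right _ _ _ := le_max_right _ _
  sup_le _ _ _ h k w := max_le (h w) (k w)
  inf_le_left _ _ _ := min_le_left _ _
  inf_le_right _ _ _ := min_le_right _ _
  le_inf _ _ _ h k w := le_min (h w) (k w)

@[simp] theorem sup_apply (f g : ChainAut Ω) (w : Ω) : (f ⊔ g) w = f w ⊔ g w := rfl

@[simp] theorem inf_apply (f g : ChainAut Ω) (w : Ω) : (f ⊓ g) w = f w ⊓ g w := rfl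

instance : MulLeftMono (ChainAut Ω) := ⟨fun f _ _ h w => h (f w)⟩

instance : MulRightMono (ChainAut Ω) := ⟨fun f _ _ h w => f.toOrderIso.monotone (h w)⟩

end ChainAut

/-! ### Right pre-orders on a partially ordered group

A partially ordered group is a type with instances `Group`, `PartialOrder`, `MulLeftMono`,
`MulRightMono`. Right pre-orders (right-invariant, proper, total, extending the partial order)
are identified with their positive cones. -/

/-- A pre-cone of a partially ordered group `G`: a proper submonoid `C` with
`G = C ∪ C⁻¹` that contains the positive cone of `G`. -/
structure PreCone (G : Type u) [Group G] [PartialOrder G] extends Submonoid G where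
  proper : carrier ≠ Set.univ
  total : ∀ a : G, a ∈ carrier ∨ a⁻¹ ∈ carrier
  pos_mem : ∀ a : G, 1 ≤ a → a ∈ carrier

namespace PreCone

section

variable {G : Type u} [Group G] [PartialOrder G]

instance : SetLike (PreCone G) G where
  coe C := C.carrier
  coe_injective C D h := by
    rcases C with ⟨⟨⟨_, _⟩, _⟩, _, _, _⟩
    rcases D with ⟨⟨⟨_, _⟩, _⟩, _, _, _⟩
    congr

/-- Pre-cones are ordered by inclusion. -/
instance : PartialOrder (PreCone G) :=
  PartialOrder.lift (fun C : PreCone G => (C : Set G)) SetLike.coe_injective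

/-- The right pre-order with positive cone `C`. -/
def Rel (C : PreCone G) (a b : G) : Prop := b * a⁻¹ ∈ C

theorem Rel.refl (C : PreCone G) (a : G) : C.Rel a a := by
  show a * a⁻¹ ∈ C.toSubmonoid
  rw [mul_inv_cancel]; exact C.toSubmonoid.one_mem

theorem Rel.trans {C : PreCone G} {a b c : G} (h : C.Rel a b) (k : C.Rel b c) : C.Rel a c := by
  have := C.toSubmonoid.mul_mem k h
  rwa [show c * b⁻¹ * (b * a⁻¹) = c * a⁻¹ by group] at this

theorem Rel.total (C : PreCone G) (a b : G) : C.Rel a b ∨ C.Rel b a := by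
  have := C.total (b * a⁻¹)
  rwa [mul_inv_rev, inv_inv] at this

theorem rel_mul_right_iff {C : PreCone G} {a b : G} (t : G) :
    C.Rel (a * t) (b * t) ↔ C.Rel a b := by
  unfold Rel
  rw [show b * t * (a * t)⁻¹ = b * a⁻¹ by group]

/-- The equivalence relation on `G` induced by the right pre-order `C`. -/
def setoid (C : PreCone G) : Setoid G where
  r a b := C.Rel a b ∧ C.Rel b a
  iseqv := ⟨fun a => ⟨.refl C a, .refl C a⟩, fun h => ⟨h.2, h.1⟩,
    fun h k => ⟨h.1.trans k.1, k.2.trans h.2⟩⟩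

/-- The chain `Ω_C`: the quotient of `G` modulo the equivalence induced by `C`. -/
def Omega (C : PreCone G) : Type u := Quotient C.setoid

/-- The class `[a]` of `a` in `Ω_C`. -/
def cls (C : PreCone G) (a : G) : C.Omega := Quotient.mk C.setoid a

noncomputable instance (C : PreCone G) : LinearOrder C.Omega where
  le := Quotient.lift₂ C.Rel fun _ _ _ _ h k => propext
    ⟨fun l => (h.2.trans l).trans k.1, fun l => (h.1.trans l).trans k.2⟩
  le_refl := by rintro ⟨a⟩; exact Rel.refl C a
  le_trans := by rintro ⟨a⟩ ⟨b⟩ ⟨c⟩ h k; exact Rel.trans h k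
  le_antisymm := by rintro ⟨a⟩ ⟨b⟩ h k; exact Quotient.sound ⟨h, k⟩
  le_total := by rintro ⟨a⟩ ⟨b⟩; exact Rel.total C a b
  toDecidableLE := Classical.decRel _

theorem cls_le_cls {C : PreCone G} {a b : G} : C.cls a ≤ C.cls b ↔ C.Rel a b := Iff.rfl

/-- Right multiplication by `a` on the chain `Ω_C`: the map `[b] ↦ [b * a]`. -/
def mulRight (C : PreCone G) (a : G) : C.Omega → C.Omega :=
  Quotient.map (fun b => b * a)
    fun _ _ h => ⟨(rel_mul_right_iff a).2 h.1, (rel_mul_right_iff a).2 h.2⟩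

/-- The action `ρ_C` of `G` on `Ω_C`, `ρ_C(a)([b]) = [b * a]`. -/
def rho (C : PreCone G) (a : G) : ChainAut C.Omega where
  toOrderIso :=
    { toFun := C.mulRight a
      invFun := C.mulRight a⁻¹
      left_inv := by
        rintro ⟨b⟩
        show C.cls (b * a * a⁻¹) = C.cls b
        rw [mul_inv_cancel_right]
      right_inv := by
        rintro ⟨b⟩
        show C.cls (b * a⁻¹ * a) = C.cls b
        rw [inv_mul_cancel_right]
      map_rel_iff' := by
        rintro ⟨b⟩ ⟨c⟩
        exact rel_mul_right_iff a }

@[simp] theorem rho_cls (C : PreCone G) (a b : G) : C.rho a (C.cls b) = C.cls (b * a) := rfl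

/-- The `ℓ`-group `H_C`: the `ℓ`-subgroup of `Aut(Ω_C)` generated by the image of `ρ_C`. -/
abbrev H (C : PreCone G) : Type u := lClosure (Set.range C.rho)

/-- The right pre-order `C` is a pre-order, that is, the pre-cone `C` is normal
(closed under conjugation). -/
def IsNormal (C : PreCone G) : Prop := ∀ a ∈ C, ∀ t : G, t⁻¹ * a * t ∈ C

/-- Normality of the cone means that the right pre-order is also left-invariant. -/
theorem isNormal_iff_leftInvariant (C : PreCone G) :
    C.IsNormal ↔ ∀ a b t : G, C.Rel a b → C.Rel (t * a) (t * b) := by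
  constructor
  · intro h a b t hab
    have := h _ hab t⁻¹
    rwa [show t⁻¹⁻¹ * (b * a⁻¹) * t⁻¹ = t * b * (t * a)⁻¹ by group] at this
  · intro h a ha t
    have := h 1 a t⁻¹ (by simpa [Rel] using ha)
    simpa [Rel] using this

end

end PreCone

/-! ### The spaces of right pre-orders and of pre-orders of a variety -/

/-- The set of right pre-orders `C` on `G` such that `H_C` belongs to the variety `V`,
ordered by inclusion. -/
abbrev RightPreorders (V : LGroupVariety) (G : Type u) [Group G] [PartialOrder G] : Type u :=
  {C : PreCone G // V.Mem C.H}

/-- The subbasic open set of all `C` with `a ∈ C` and `a⁻¹ ∉ C`. -/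
def RightPreorders.basicOpen (V : LGroupVariety) {G : Type u} [Group G] [PartialOrder G]
    (a : G) : Set (RightPreorders V G) :=
  {C | a ∈ C.1 ∧ a⁻¹ ∉ C.1}

/-- The smallest topology containing all the sets `basicOpen V a`. -/
instance RightPreorders.instTopologicalSpace (V : LGroupVariety) (G : Type u) [Group G]
    [PartialOrder G] : TopologicalSpace (RightPreorders V G) :=
  TopologicalSpace.generateFrom (Set.range (RightPreorders.basicOpen V))

/-- The (two-sided) pre-orders among the right pre-orders of the variety `V`. -/
def Preorders (V : LGroupVariety) (G : Type u) [Group G] [PartialOrder G] :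
    Set (RightPreorders V G) :=
  {C | C.1.IsNormal}

/-! ### Interior operators and generalised spectral spaces -/

/-- Interior operators on a partially ordered set. -/
structure IsInteriorOperator {S : Type v} [PartialOrder S] (f : S → S) : Prop where
  contracting : ∀ x, f x ≤ x
  monotone : Monotone f
  idempotent : ∀ x, f (f x) = f x

/-- A generalised spectral space: a sober space (every nonempty irreducible closed set is the
closure of a unique point) whose compact open subsets form a base closed under finite
intersections. Compactness of the whole space is not required. -/
structure IsGeneralisedSpectral (X : Type v) [TopologicalSpace X] : Prop where
  sober : ∀ Y : Set X, IsClosed Y → IsIrreducible Y → ∃! x : X, closure {x} = Y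
  isTopologicalBasis : TopologicalSpace.IsTopologicalBasis {U : Set X | IsOpen U ∧ IsCompact U}
  isCompact_inter : ∀ U W : Set X, IsOpen U → IsCompact U → IsOpen W → IsCompact W →
    IsCompact (U ∩ W)

/-!
A set of cones carries the topology whose basic open sets consist of the cones avoiding a nonempty
finite set. If every proper limit of its members along an ultrafilter is again a member, then the
basic open sets are compact, and an irreducible closed set has as generic point the limit along an
ultrafilter containing all its dense open subsets; so the space is generalised spectral. For a
pre-order `C`, the condition `H_C ∈ V` says that the equations of `V` hold in `G` modulo `C`; each
instance of an equation involves only finitely many memberships in `C`, so this condition passes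
to ultrafilter limits, as in Łoś's theorem.

In a representable `ℓ`-group the positive part of an element is orthogonal to all conjugates of its
negative part. As `H_C` acts transitively on the chain `Ω_C`, evaluating this at a point shows that
no element of `H_C` moves one point up and another one down. Hence if `H_C` is representable, the
intersection `β(C)` of the conjugates of `C`, which is the set of elements of `G` acting on `Ω_C` as
increasing maps, is the cone of a pre-order, and `H_C` satisfies the equations that hold
modulo `β(C)`. Finally `a ∉ β(C)` means `t a t⁻¹ ∉ C` for some `t`, an open condition on `C`.
-/

open Filter Set Topology TopologicalSpace

/-! ### Ultrafilter limits and hull-kernel topologies -/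

section Ultralimits

variable {X A : Type*} {f : Ultrafilter X} {D : X → Set A}

/-- The limit of a family of subsets of `A` along an ultrafilter: the set of those elements that
belong to almost all members of the family. -/
def ultralimit (f : Ultrafilter X) (D : X → Set A) : Set A := {a | ∀ᶠ x in f, a ∈ D x}

theorem notMem_ultralimit {a : A} : a ∉ ultralimit f D ↔ ∀ᶠ x in f, a ∉ D x :=
  Ultrafilter.eventually_not.symm

theorem eventually_mem_iff_mem_ultralimit (f : Ultrafilter X) (D : X → Set A) (a : A) :
    ∀ᶠ x in f, a ∈ D x ↔ a ∈ ultralimit f D := by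
  by_cases ha : a ∈ ultralimit f D
  · filter_upwards [show ∀ᶠ x in f, a ∈ D x from ha] with x hx using iff_of_true hx ha
  · filter_upwards [notMem_ultralimit.1 ha] with x hx using iff_of_false hx ha

end Ultralimits

section HullKernel

theorem generateFrom_range_eq_induced {X A : Type*} (S : A → Set X) :
    generateFrom (range S) = .induced (fun x a => x ∈ S a) Pi.topologicalSpace := by
  refine le_antisymm ?_ (le_generateFrom ?_)
  · rw [induced_to_pi]
    exact le_iInf fun a => continuous_iff_le_induced.1 <|
      (@continuous_Prop X (_) _).2 (isOpen_generateFrom_of_mem ⟨a, rfl⟩)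
  · rintro _ ⟨a, rfl⟩
    exact ⟨{p | p a}, continuous_Prop.1 (continuous_apply a), rfl⟩

theorem exists_ultrafilter_of_isIrreducible {X : Type*} [TopologicalSpace X] {Y : Set X}
    (hY : IsIrreducible Y) :
    ∃ f : Ultrafilter X, Y ∈ f ∧ ∀ U, IsOpen U → (Y ∩ U).Nonempty → U ∈ f := by
  have hY_univ : (Y ∩ univ).Nonempty := by simpa only [inter_univ] using hY.nonempty
  let g : Filter X :=
    { sets := {s | ∃ U, IsOpen U ∧ (Y ∩ U).Nonempty ∧ Y ∩ U ⊆ s}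
      univ_sets := ⟨univ, isOpen_univ, hY_univ, subset_univ _⟩
      sets_of_superset := fun ⟨U, hU, hYU, hUs⟩ hst => ⟨U, hU, hYU, hUs.trans hst⟩
      inter_sets := fun ⟨U, hU, hYU, hUs⟩ ⟨W, hW, hYW, hWt⟩ =>
        ⟨U ∩ W, hU.inter hW, hY.isPreirreducible U W hU hW hYU hYW,
          fun _ hx => ⟨hUs ⟨hx.1, hx.2.1⟩, hWt ⟨hx.1, hx.2.2⟩⟩⟩ }
  have : NeBot g := ⟨fun h =>
    let ⟨_, _, hYU, hU⟩ := empty_mem_iff_bot.2 h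
    (hYU.mono hU).ne_empty rfl⟩
  exact ⟨.of g, Ultrafilter.of_le g ⟨univ, isOpen_univ, hY_univ, inter_subset_left⟩,
    fun U hU hYU => Ultrafilter.of_le g ⟨U, hU, hYU, inter_subset_right⟩⟩

variable {X A : Type*} {D : X → Set A}

/-- The basic open set of the hull-kernel topology on a family `D` of subsets of `A` that consists
of the members avoiding `F`. -/
def hullKernelBasicOpen (D : X → Set A) (F : Set A) : Set X := {x | ∀ a ∈ F, a ∉ D x}

theorem hullKernelBasicOpen_union (F F' : Set A) :
    hullKernelBasicOpen D (F ∪ F') = hullKernelBasicOpen D F ∩ hullKernelBasicOpen D F' :=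
  ext fun _ => forall₂_or_left

variable [TopologicalSpace X]

/- With the Sierpiński topology on `Prop`, the hypothesis `IsEmbedding fun x a => a ∉ D x` says that
`D` is injective and that the sets `{x | a ∉ D x}` form a subbasis of the topology of `X`. -/

theorem isOpen_notMem (hD : Continuous fun x a => a ∉ D x) (a : A) : IsOpen {x | a ∉ D x} :=
  continuous_Prop.1 ((continuous_apply a).comp hD)

theorem isOpen_hullKernelBasicOpen (hD : Continuous fun x a => a ∉ D x) {F : Set A}
    (hF : F.Finite) : IsOpen (hullKernelBasicOpen D F) := by
  rw [show hullKernelBasicOpen D F = ⋂ a ∈ F, {x | a ∉ D x} by ext; simp [hullKernelBasicOpen]]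
  exact hF.isOpen_biInter fun a _ => isOpen_notMem hD a

theorem le_nhds_iff_eventually_notMem (hD : IsInducing fun x a => a ∉ D x) {f : Filter X} {x : X} :
    f ≤ 𝓝 x ↔ ∀ a ∉ D x, ∀ᶠ y in f, a ∉ D y := by
  rw [← tendsto_id', hD.tendsto_nhds_iff]
  simp only [tendsto_pi_nhds, tendsto_nhds_Prop, Function.comp_id]

theorem le_nhds_of_eq_ultralimit (hD : IsInducing fun x a => a ∉ D x) {f : Ultrafilter X} {x : X}
    (hx : D x = ultralimit f D) : ↑f ≤ 𝓝 x :=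
  (le_nhds_iff_eventually_notMem hD).2 fun _ ha => notMem_ultralimit.1 (hx ▸ ha)

theorem specializes_iff_subset (hD : IsInducing fun x a => a ∉ D x) {x y : X} :
    x ⤳ y ↔ D x ⊆ D y := by
  rw [specializes_iff_pure, le_nhds_iff_eventually_notMem hD]
  simp only [eventually_pure, not_imp_not, subset_def]

theorem isTopologicalBasis_hullKernelBasicOpen (hD : IsInducing fun x a => a ∉ D x)
    (hproper : ∀ x, D x ≠ univ) :
    IsTopologicalBasis
      (range fun F : {F : Set A // F.Finite ∧ F.Nonempty} => hullKernelBasicOpen D F) where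
  exists_subset_inter := by
    rintro _ ⟨⟨F, hF, hF₀⟩, rfl⟩ _ ⟨⟨F', hF', _⟩, rfl⟩ x hx
    exact ⟨_, ⟨⟨F ∪ F', hF.union hF', hF₀.inl⟩, rfl⟩, (hullKernelBasicOpen_union F F').ge hx,
      (hullKernelBasicOpen_union F F').le⟩
  sUnion_eq := eq_univ_of_forall fun x =>
    let ⟨a, ha⟩ := (ne_univ_iff_exists_notMem _).1 (hproper x)
    ⟨_, ⟨⟨{a}, finite_singleton a, singleton_nonempty a⟩, rfl⟩, forall_eq.2 ha⟩
  eq_generateFrom := by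
    refine le_antisymm (le_generateFrom ?_) ?_
    · rintro _ ⟨F, rfl⟩
      exact isOpen_hullKernelBasicOpen hD.continuous F.2.1
    · rw [hD.eq_induced]
      refine (generateFrom_anti ?_).trans (generateFrom_range_eq_induced fun a => {x | a ∉ D x}).le
      rintro _ ⟨a, rfl⟩
      refine ⟨⟨{a}, finite_singleton a, singleton_nonempty a⟩, ?_⟩
      simp only [hullKernelBasicOpen, mem_singleton_iff, forall_eq]

theorem isCompact_hullKernelBasicOpen (hD : IsInducing fun x a => a ∉ D x)
    (hlim : ∀ f : Ultrafilter X, ultralimit f D ≠ univ → ultralimit f D ∈ range D)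
    {F : Set A} (hF : F.Nonempty) : IsCompact (hullKernelBasicOpen D F) := by
  rw [isCompact_iff_ultrafilter_le_nhds]
  intro f hf
  have hlimF : ∀ a ∈ F, a ∉ ultralimit f D := fun a ha =>
    notMem_ultralimit.2 (mem_of_superset (le_principal_iff.1 hf) fun _ hx => hx a ha)
  obtain ⟨a, ha⟩ := hF
  obtain ⟨x, hx⟩ := hlim f (ne_univ_iff_exists_notMem _ |>.2 ⟨a, hlimF a ha⟩)
  exact ⟨x, fun b hb => hx ▸ hlimF b hb, le_nhds_of_eq_ultralimit hD hx⟩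

theorem quasiSober_of_ultralimit_mem_range (hD : IsInducing fun x a => a ∉ D x)
    (hproper : ∀ x, D x ≠ univ)
    (hlim : ∀ f : Ultrafilter X, ultralimit f D ≠ univ → ultralimit f D ∈ range D) :
    QuasiSober X where
  sober {Y} hirr hY := by
    obtain ⟨f, hfY, hf⟩ := exists_ultrafilter_of_isIrreducible hirr
    -- An element missing from `D y` for one `y ∈ Y` is missing from almost all members.
    have hsub : ∀ y ∈ Y, ultralimit f D ⊆ D y := fun y hy a ha => by
      by_contra hay
      exact notMem_ultralimit.2 (hf _ (isOpen_notMem hD.continuous a) ⟨y, hy, hay⟩) ha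
    obtain ⟨y₀, hy₀⟩ := hirr.nonempty
    obtain ⟨x, hx⟩ := hlim f fun h => hproper y₀ (univ_subset_iff.1 (h ▸ hsub y₀ hy₀))
    have hxY : x ∈ Y := isClosed_iff_ultrafilter.1 hY x f (le_nhds_of_eq_ultralimit hD hx) hfY
    refine ⟨x, isGenericPoint_iff_specializes.2 fun y =>
      ⟨fun h => h.mem_closed hY hxY, fun hy => (specializes_iff_subset hD).2 ?_⟩⟩
    exact hx ▸ hsub y hy

theorem IsGeneralisedSpectral.of_instances (X : Type*) [TopologicalSpace X] [T0Space X]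
    [QuasiSober X] [PrespectralSpace X] [QuasiSeparatedSpace X] : IsGeneralisedSpectral X where
  sober _ hY hirr :=
    (QuasiSober.sober hirr hY).imp fun _ hx => ⟨hx, fun _ hy => IsGenericPoint.eq hy hx⟩
  isTopologicalBasis := PrespectralSpace.isTopologicalBasis
  isCompact_inter U W hU hU' hW hW' := QuasiSeparatedSpace.inter_isCompact U W hU hU' hW hW'

theorem IsGeneralisedSpectral.of_ultralimit_mem_range (hD : IsEmbedding fun x a => a ∉ D x)
    (hproper : ∀ x, D x ≠ univ)
    (hlim : ∀ f : Ultrafilter X, ultralimit f D ≠ univ → ultralimit f D ∈ range D) :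
    IsGeneralisedSpectral X := by
  have hbasis := isTopologicalBasis_hullKernelBasicOpen hD.isInducing hproper
  have hcompact {F : Set A} (hF : F.Nonempty) : IsCompact (hullKernelBasicOpen D F) :=
    isCompact_hullKernelBasicOpen hD.isInducing hlim hF
  have := hD.t0Space
  have := quasiSober_of_ultralimit_mem_range hD.isInducing hproper hlim
  have := PrespectralSpace.of_isTopologicalBasis' hbasis fun F => hcompact F.2.2
  have : QuasiSeparatedSpace X := .of_isTopologicalBasis hbasis fun F F' => by
    rw [← hullKernelBasicOpen_union]
    exact hcompact F.2.2.inl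
  exact .of_instances X

end HullKernel

/-! ### Equations modulo a cone -/

section ConeEval

variable {G : Type*} [Group G]

namespace LTerm

theorem eval_map {H K : Type*} [Group H] [Lattice H] [Group K] [Lattice K] (φ : H →* K)
    (hsup : ∀ x y, φ (x ⊔ y) = φ x ⊔ φ y) (hinf : ∀ x y, φ (x ⊓ y) = φ x ⊓ φ y)
    (x : ℕ → H) (t : LTerm) : t.eval (φ ∘ x) = φ (t.eval x) := by
  induction t with
  | var n => rfl
  | one => exact (map_one φ).symm
  | mul s t hs ht => simp only [eval, hs, ht, map_mul]
  | inv s hs => simp only [eval, hs, map_inv]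
  | sup s t hs ht => simp only [eval, hs, ht, hsup]
  | inf s t hs ht => simp only [eval, hs, ht, hinf]

open Classical in
/-- The value of a term in a group `G` in which joins and meets are taken with respect to the total
right pre-order with positive cone `D`. On equivalent arguments, `sup` returns the second and `inf`
the first; the choice is immaterial up to equivalence. -/
noncomputable def coneEval (D : Set G) (x : ℕ → G) : LTerm → G
  | .var n => x n
  | .one => 1
  | .mul s t => s.coneEval D x * t.coneEval D x
  | .inv s => (s.coneEval D x)⁻¹
  | .sup s t =>
      if t.coneEval D x * (s.coneEval D x)⁻¹ ∈ D then t.coneEval D x else s.coneEval D x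
  | .inf s t =>
      if t.coneEval D x * (s.coneEval D x)⁻¹ ∈ D then s.coneEval D x else t.coneEval D x

theorem eventually_coneEval_eq_ultralimit {X : Type*} (f : Ultrafilter X) (D : X → Set G)
    (x : ℕ → G) (t : LTerm) :
    ∀ᶠ i in f, t.coneEval (D i) x = t.coneEval (ultralimit f D) x := by
  induction t with
  | var n => exact .of_forall fun _ => rfl
  | one => exact .of_forall fun _ => rfl
  | mul s t hs ht =>
    filter_upwards [hs, ht] with i hsi hti
    simp only [coneEval, hsi, hti]
  | inv s hs =>
    filter_upwards [hs] with i hsi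
    simp only [coneEval, hsi]
  | sup s t hs ht =>
    filter_upwards [hs, ht, eventually_mem_iff_mem_ultralimit f D
      (t.coneEval (ultralimit f D) x * (s.coneEval (ultralimit f D) x)⁻¹)] with i hsi hti hi
    rw [coneEval, coneEval, hsi, hti, hi]
  | inf s t hs ht =>
    filter_upwards [hs, ht, eventually_mem_iff_mem_ultralimit f D
      (t.coneEval (ultralimit f D) x * (s.coneEval (ultralimit f D) x)⁻¹)] with i hsi hti hi
    rw [coneEval, coneEval, hsi, hti, hi]

end LTerm

namespace LGroupVariety

variable {V : LGroupVariety}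

/-- The equations of `V` hold in `G` up to the equivalence of the pre-order with positive
cone `D`. -/
def HoldsInCone (V : LGroupVariety) (D : Set G) : Prop :=
  ∀ e ∈ V.equations, ∀ x : ℕ → G,
    e.1.coneEval D x * (e.2.coneEval D x)⁻¹ ∈ D ∧ e.2.coneEval D x * (e.1.coneEval D x)⁻¹ ∈ D

theorem HoldsInCone.ultralimit {X : Type*} {f : Ultrafilter X} {D : X → Set G}
    (h : ∀ i, V.HoldsInCone (D i)) : V.HoldsInCone (ultralimit f D) := by
  intro e he x
  rw [← eventually_const (f := (f : Filter X)) (p := _ ∧ _)]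
  filter_upwards [e.1.eventually_coneEval_eq_ultralimit f D x,
    e.2.eventually_coneEval_eq_ultralimit f D x,
    eventually_mem_iff_mem_ultralimit f D _, eventually_mem_iff_mem_ultralimit f D _]
    with i h₁ h₂ h₁₂ h₂₁
  rw [← h₁₂, ← h₂₁, ← h₁, ← h₂]
  exact h i e he x

end LGroupVariety

end ConeEval

section LClosure

theorem subset_lClosure {H : Type*} [Group H] [Lattice H] {S : Set H} : S ⊆ lClosure S :=
  fun _ hx => Subgroup.mem_sInf.2 fun _ hK => hK.1 hx

theorem LGroupVariety.mem_lClosure_iff {V : LGroupVariety} {H : Type*} [Group H] [Lattice H]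
    [MulLeftMono H] [MulRightMono H] {S : Set H} :
    V.Mem (lClosure S) ↔
      ∀ e ∈ V.equations, ∀ x : ℕ → H, (∀ n, x n ∈ lClosure S) → e.1.eval x = e.2.eval x := by
  have heval (x : ℕ → lClosure S) (t : LTerm) :
      t.eval (Subtype.val ∘ x) = (t.eval x : lClosure S) :=
    t.eval_map (lClosure S).subtype (fun _ _ => rfl) (fun _ _ => rfl) x
  refine forall₂_congr fun e _ => ⟨fun h x hx => ?_, fun h x => Subtype.ext ?_⟩
  · let y : ℕ → lClosure S := fun n => ⟨x n, hx n⟩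
    exact (heval y e.1).trans ((congrArg Subtype.val (h y)).trans (heval y e.2).symm)
  · rw [← heval, ← heval]
    exact h _ fun n => (x n).2

variable {G K : Type*} [Group G] [Group K] [Lattice K] [MulRightMono K] {φ : G →* K}

theorem map_le_map_iff_one_le_map_mul_inv {a b : G} : φ a ≤ φ b ↔ 1 ≤ φ (b * a⁻¹) := by
  rw [map_mul, map_inv, le_mul_inv_iff_mul_le, one_mul]

theorem map_le_map_total (hφ : ∀ a, 1 ≤ φ a ∨ φ a ≤ 1) (a b : G) : φ a ≤ φ b ∨ φ b ≤ φ a := by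
  have := hφ (b * a⁻¹)
  rwa [map_mul, map_inv, le_mul_inv_iff_mul_le, mul_inv_le_iff_le_mul, one_mul] at this

theorem LTerm.eval_comp_eq_map_coneEval (hφ : ∀ a, 1 ≤ φ a ∨ φ a ≤ 1) (x : ℕ → G) (t : LTerm) :
    t.eval (φ ∘ x) = φ (t.coneEval {a | 1 ≤ φ a} x) := by
  have hle {a b : G} (h : ¬1 ≤ φ (b * a⁻¹)) : φ b ≤ φ a :=
    (map_le_map_total hφ a b).resolve_left (mt map_le_map_iff_one_le_map_mul_inv.1 h)
  induction t with
  | var n => rfl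
  | one => exact (map_one φ).symm
  | mul s t hs ht => simp only [eval, coneEval, hs, ht, map_mul]
  | inv s hs => simp only [eval, coneEval, hs, map_inv]
  | sup s t hs ht =>
    simp only [eval, coneEval, hs, ht]
    split_ifs with h
    · exact sup_eq_right.2 (map_le_map_iff_one_le_map_mul_inv.2 h)
    · exact sup_eq_left.2 (hle h)
  | inf s t hs ht =>
    simp only [eval, coneEval, hs, ht]
    split_ifs with h
    · exact inf_eq_left.2 (map_le_map_iff_one_le_map_mul_inv.2 h)
    · exact inf_eq_right.2 (hle h)

theorem lClosure_range_eq_range (hφ : ∀ a, 1 ≤ φ a ∨ φ a ≤ 1) :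
    lClosure (range φ) = φ.range := by
  refine le_antisymm (sInf_le ⟨fun _ h => h, ?_⟩) fun _ h => subset_lClosure h
  rintro _ ⟨a, rfl⟩ _ ⟨b, rfl⟩
  rcases map_le_map_total hφ a b with h | h
  · simp [h]
  · simp [h]

theorem LGroupVariety.mem_lClosure_range_iff [MulLeftMono K] {V : LGroupVariety}
    (hφ : ∀ a, 1 ≤ φ a ∨ φ a ≤ 1) :
    V.Mem (lClosure (range φ)) ↔ V.HoldsInCone {a | 1 ≤ φ a} := by
  rw [mem_lClosure_iff, lClosure_range_eq_range hφ]
  have heq (a b : G) : φ a = φ b ↔ 1 ≤ φ (a * b⁻¹) ∧ 1 ≤ φ (b * a⁻¹) := by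
    rw [← map_le_map_iff_one_le_map_mul_inv, ← map_le_map_iff_one_le_map_mul_inv, and_comm,
      le_antisymm_iff]
  refine forall₂_congr fun e _ => ⟨fun h x => ?_, fun h y hy => ?_⟩
  · have := h (φ ∘ x) fun n => ⟨x n, rfl⟩
    rwa [LTerm.eval_comp_eq_map_coneEval hφ, LTerm.eval_comp_eq_map_coneEval hφ, heq] at this
  · choose x hx using hy
    obtain rfl : φ ∘ x = y := funext hx
    rw [LTerm.eval_comp_eq_map_coneEval hφ, LTerm.eval_comp_eq_map_coneEval hφ, heq]
    exact h x

end LClosure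

/-! ### Representability and the core of a right pre-order -/

section Representable

namespace IsRepresentableLGroup

theorem sup_one_inf_conj_eq_one {H : Type*} [Group H] [Lattice H] [MulLeftMono H] [MulRightMono H]
    (h : IsRepresentableLGroup H) (x y : H) : (x ⊔ 1) ⊓ (y⁻¹ * (x⁻¹ ⊔ 1) * y) = 1 := by
  obtain ⟨ι, T, _, _, _, _, φ, hφ, hsup, hinf, -⟩ := h
  refine hφ (funext fun i => ?_)
  simp only [hinf, hsup, map_mul, map_inv, map_one, Pi.inf_apply, Pi.sup_apply, Pi.mul_apply,
    Pi.inv_apply, Pi.one_apply]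
  rcases le_total (φ x i) 1 with hx | hx
  · have hconj : 1 ≤ (φ y i)⁻¹ * ((φ x i)⁻¹ ⊔ 1) * φ y i :=
      calc (1 : T i) = (φ y i)⁻¹ * 1 * φ y i := by simp
        _ ≤ _ := by gcongr; exact le_sup_right
    rw [sup_eq_right.2 hx, inf_eq_left.2 hconj]
  · rw [sup_eq_right.2 (inv_le_one'.2 hx)]
    simp

theorem one_le_or_le_one_of_transitive {Ω : Type*} [LinearOrder Ω] {S : Set (ChainAut Ω)}
    (h : IsRepresentableLGroup (lClosure S)) (htrans : ∀ v w, ∃ g ∈ lClosure S, g v = w)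
    {f : ChainAut Ω} (hf : f ∈ lClosure S) : 1 ≤ f ∨ f ≤ 1 := by
  by_contra! hcon
  obtain ⟨w, hw⟩ : ∃ w, f w < w := by simpa using not_forall.1 hcon.1
  obtain ⟨v, hv⟩ : ∃ v, v < f v := by simpa using not_forall.1 hcon.2
  obtain ⟨g, hg, rfl⟩ := htrans w v
  have horth : (f ⊔ 1) ⊓ (g⁻¹ * (f⁻¹ ⊔ 1) * g) = 1 :=
    congrArg Subtype.val (h.sup_one_inf_conj_eq_one ⟨f, hf⟩ ⟨g, hg⟩)
  have hw' : w < f⁻¹ w := f.toOrderIso.lt_symm_apply.2 hw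
  have hgw : g w < g (f⁻¹ w) := g.toOrderIso.strictMono hw'
  have horth_gw := congrArg (fun k : ChainAut Ω => k (g w)) horth
  have hinv : g⁻¹ (g w) = w := g.toOrderIso.symm_apply_apply w
  simp only [ChainAut.inf_apply, ChainAut.sup_apply, ChainAut.mul_apply, ChainAut.one_apply,
    hinv, max_eq_left hv.le, max_eq_left hw'.le] at horth_gw
  exact (lt_min hv hgw).ne' horth_gw

end IsRepresentableLGroup

end Representable

namespace PreCone

variable {G : Type*} [Group G] [PartialOrder G]

instance : SubmonoidClass (PreCone G) G where
  mul_mem {C} _ _ ha hb := C.toSubmonoid.mul_mem ha hb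
  one_mem C := C.toSubmonoid.one_mem

theorem exists_cls_eq (C : PreCone G) (w : C.Omega) : ∃ a, C.cls a = w := Quotient.exists_rep w

/-- The action of `G` on the chain `Ω_C` by right multiplication, as a homomorphism. -/
def rhoHom (C : PreCone G) : G →* ChainAut C.Omega where
  toFun := C.rho
  map_one' := ChainAut.ext fun w => by
    obtain ⟨b, rfl⟩ := C.exists_cls_eq w
    simp
  map_mul' a a' := ChainAut.ext fun w => by
    obtain ⟨b, rfl⟩ := C.exists_cls_eq w
    simp [mul_assoc]

/-- The intersection of the conjugates of `C`, encoded as the set of those elements that act on the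
chain `Ω_C` as increasing maps. -/
noncomputable def core (C : PreCone G) : Submonoid G :=
  (Submonoid.oneLE (ChainAut C.Omega)).comap C.rhoHom

theorem mem_core {C : PreCone G} {a : G} : a ∈ C.core ↔ ∀ t, t * a * t⁻¹ ∈ C := by
  refine ⟨fun h t => cls_le_cls.1 (h (C.cls t)), fun h w => ?_⟩
  obtain ⟨t, rfl⟩ := C.exists_cls_eq w
  exact cls_le_cls.2 (h t)

theorem core_subset (C : PreCone G) : (C.core : Set G) ⊆ C := fun a ha => by
  simpa using mem_core.1 ha 1

theorem conj_mem_core {C : PreCone G} {a : G} (ha : a ∈ C.core) (t : G) :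
    t * a * t⁻¹ ∈ C.core :=
  mem_core.2 fun s => by simpa [mul_assoc] using mem_core.1 ha (s * t)

theorem coe_core_eq_iInter (C : PreCone G) :
    (C.core : Set G) = ⋂ t : G, (fun c => t⁻¹ * c * t) '' (C : Set G) := by
  ext a
  rw [SetLike.mem_coe, mem_core, mem_iInter]
  refine forall_congr' fun t => ⟨fun h => ⟨_, h, by group⟩, ?_⟩
  rintro ⟨c, hc, rfl⟩
  simpa [mul_assoc] using hc

theorem isNormal_iff_coe_core_eq {C : PreCone G} : C.IsNormal ↔ (C.core : Set G) = C := by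
  refine ⟨fun h => C.core_subset.antisymm fun a ha => mem_core.2 fun t => ?_, fun h a ha t => ?_⟩
  · simpa using h a ha t⁻¹
  · rw [← SetLike.mem_coe, ← h] at ha ⊢
    simpa using conj_mem_core ha t⁻¹

/-- The core of `C` is the positive cone of a total relation, which makes it the cone of a
pre-order. -/
def HasTotalCore (C : PreCone G) : Prop := ∀ a, a ∈ C.core ∨ a⁻¹ ∈ C.core

theorem IsNormal.hasTotalCore {C : PreCone G} (h : C.IsNormal) : C.HasTotalCore := fun a =>
  have hC := (isNormal_iff_coe_core_eq.1 h).ge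
  (C.total a).imp (@hC _) (@hC _)

theorem hasTotalCore_iff {C : PreCone G} :
    C.HasTotalCore ↔ ∀ a, 1 ≤ C.rhoHom a ∨ C.rhoHom a ≤ 1 := by
  refine forall_congr' fun a => or_congr Iff.rfl ?_
  rw [← one_le_inv', ← map_inv]
  exact Iff.rfl

theorem hasTotalCore_of_isRepresentable {C : PreCone G} (h : IsRepresentableLGroup C.H) :
    C.HasTotalCore := by
  refine hasTotalCore_iff.2 fun a =>
    h.one_le_or_le_one_of_transitive (fun v w => ?_) (subset_lClosure ⟨a, rfl⟩)
  obtain ⟨b, rfl⟩ := C.exists_cls_eq v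
  obtain ⟨c, rfl⟩ := C.exists_cls_eq w
  exact ⟨C.rho (b⁻¹ * c), subset_lClosure ⟨_, rfl⟩, by simp⟩

theorem HasTotalCore.mem_H_iff {C : PreCone G} (h : C.HasTotalCore) {V : LGroupVariety} :
    V.Mem C.H ↔ V.HoldsInCone (C.core : Set G) :=
  LGroupVariety.mem_lClosure_range_iff (φ := C.rhoHom) (hasTotalCore_iff.1 h)

theorem IsNormal.mem_H_iff {C : PreCone G} (h : C.IsNormal) {V : LGroupVariety} :
    V.Mem C.H ↔ V.HoldsInCone (C : Set G) := by
  rw [h.hasTotalCore.mem_H_iff, isNormal_iff_coe_core_eq.1 h]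

/-- A proper limit of right pre-orders along an ultrafilter, as a right pre-order. -/
def ofUltralimit {X : Type*} (f : Ultrafilter X) (C : X → PreCone G)
    (h : ultralimit f (fun i => (C i : Set G)) ≠ univ) : PreCone G where
  carrier := ultralimit f fun i => (C i : Set G)
  one_mem' := .of_forall fun i => one_mem (C i)
  mul_mem' ha hb := ha.mp (hb.mono fun _ hb ha => mul_mem ha hb)
  proper := h
  total a := Ultrafilter.eventually_or.1 (.of_forall fun i => (C i).total a)
  pos_mem a ha := .of_forall fun i => (C i).pos_mem a ha

theorem IsNormal.ofUltralimit {X : Type*} {f : Ultrafilter X} {C : X → PreCone G}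
    {h : ultralimit f (fun i => (C i : Set G)) ≠ univ} (hC : ∀ i, (C i).IsNormal) :
    (ofUltralimit f C h).IsNormal :=
  fun a ha t => ha.mono fun i hi => hC i a hi t

/-- The core of `C`, if total, as a right pre-order; this is `β(C)`. -/
noncomputable def coreCone [MulLeftMono G] [MulRightMono G] (C : PreCone G) (h : C.HasTotalCore) :
    PreCone G where
  toSubmonoid := C.core
  proper hcore := C.proper (univ_subset_iff.1 (hcore ▸ C.core_subset))
  total := h
  pos_mem a ha := mem_core.2 fun t => C.pos_mem _ <|
    calc 1 = t * 1 * t⁻¹ := by simp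
      _ ≤ t * a * t⁻¹ := by gcongr

theorem isNormal_coreCone [MulLeftMono G] [MulRightMono G] (C : PreCone G) (h : C.HasTotalCore) :
    (C.coreCone h).IsNormal :=
  isNormal_iff_coe_core_eq.2 <| (C.coreCone h).core_subset.antisymm fun _ ha =>
    mem_core.2 (conj_mem_core ha)

end PreCone

/-! ### The spaces of right pre-orders and of pre-orders -/

section Spaces

variable {V : LGroupVariety} {G : Type*} [Group G] [PartialOrder G]

namespace RightPreorders

theorem basicOpen_inv (a : G) : basicOpen V a⁻¹ = {C : RightPreorders V G | a ∉ (C.1 : Set G)} :=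
  ext fun C => by
    rw [basicOpen, inv_inv]
    exact and_iff_right_of_imp (C.1.total a).resolve_left

theorem isEmbedding_notMem :
    IsEmbedding fun (C : RightPreorders V G) (a : G) => a ∉ (C.1 : Set G) where
  eq_induced := by
    rw [instTopologicalSpace, ← (Equiv.inv G).surjective.range_comp]
    exact (congrArg (fun S => generateFrom (range S)) (funext basicOpen_inv)).trans
      (generateFrom_range_eq_induced _)
  injective C D h := Subtype.ext <| SetLike.ext fun a => not_iff_not.1 (congrFun h a).to_iff

end RightPreorders

namespace Preorders

theorem isEmbedding_notMem :
    IsEmbedding fun (C : Preorders V G) (a : G) => a ∉ (C.1.1 : Set G) :=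
  RightPreorders.isEmbedding_notMem.comp .subtypeVal

theorem ultralimit_mem_range (f : Ultrafilter (Preorders V G))
    (hf : ultralimit f (fun C => (C.1.1 : Set G)) ≠ univ) :
    ultralimit f (fun C => (C.1.1 : Set G)) ∈ range fun C : Preorders V G => (C.1.1 : Set G) := by
  let C := PreCone.ofUltralimit f (fun C => C.1.1) hf
  have hC : C.IsNormal := .ofUltralimit fun D => D.2
  exact ⟨⟨⟨C, hC.mem_H_iff.2 <| .ultralimit fun D => D.2.mem_H_iff.1 D.1.2⟩, hC⟩, rfl⟩

theorem isGeneralisedSpectral (V : LGroupVariety) (G : Type*) [Group G] [PartialOrder G] :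
    IsGeneralisedSpectral (Preorders V G) :=
  .of_ultralimit_mem_range isEmbedding_notMem (fun C => C.1.1.proper) ultralimit_mem_range

end Preorders

namespace RightPreorders

theorem hasTotalCore {G : Type u} [Group G] [PartialOrder G]
    (hV : LGroupVariety.IsRepresentable.{u} V) (C : RightPreorders V G) : C.1.HasTotalCore :=
  PreCone.hasTotalCore_of_isRepresentable (hV _ C.2)

variable {G : Type u} [Group G] [PartialOrder G] [MulLeftMono G] [MulRightMono G]
  (hV : LGroupVariety.IsRepresentable.{u} V)

/-- The operator `β`, which sends a right pre-order to the largest pre-order contained in it. -/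
noncomputable def beta (C : RightPreorders V G) : RightPreorders V G :=
  ⟨C.1.coreCone (hasTotalCore hV C), (C.1.isNormal_coreCone _).mem_H_iff.2 <|
    (hasTotalCore hV C).mem_H_iff.1 C.2⟩

theorem coe_beta (C : RightPreorders V G) : ((beta hV C).1 : Set G) = C.1.core := rfl

theorem beta_mem_preorders (C : RightPreorders V G) : beta hV C ∈ Preorders V G :=
  C.1.isNormal_coreCone _

theorem beta_eq_self {C : RightPreorders V G} (hC : C ∈ Preorders V G) : beta hV C = C :=
  Subtype.ext <| SetLike.coe_injective <| PreCone.isNormal_iff_coe_core_eq.1 hC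

theorem fixedPoints_beta : Function.fixedPoints (beta (G := G) hV) = Preorders V G :=
  ext fun C => ⟨fun h => h ▸ beta_mem_preorders hV C, beta_eq_self hV⟩

theorem isInteriorOperator_beta : IsInteriorOperator (beta (G := G) hV) where
  contracting C := C.1.core_subset
  monotone _ _ h _ ha := PreCone.mem_core.2 fun t => h (PreCone.mem_core.1 ha t)
  idempotent C := beta_eq_self hV (beta_mem_preorders hV C)

theorem continuous_beta : Continuous (beta (G := G) hV) := by
  refine isEmbedding_notMem.continuous_iff.2 <| continuous_pi fun a => continuous_Prop.2 ?_
  have hpreimage : {C | a ∉ ((beta hV C).1 : Set G)} =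
      ⋃ t : G, {C : RightPreorders V G | t * a * t⁻¹ ∉ (C.1 : Set G)} := by
    ext C
    simp [coe_beta, PreCone.mem_core]
  exact hpreimage ▸ isOpen_iUnion fun t => isOpen_notMem isEmbedding_notMem.continuous _

end RightPreorders

end Spaces

theorem theorem7p9 (G : Type u) [Group G] [PartialOrder G] [MulLeftMono G] [MulRightMono G]
    (V : LGroupVariety) (hV : LGroupVariety.IsRepresentable.{u} V) :
    -- the subspace of pre-orders is generalised spectral
    IsGeneralisedSpectral (Preorders V G) ∧
    -- `C ↦ ⋂ t, t⁻¹ C t` is a well-defined map on the right pre-orders of `V`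
    ∃ β : RightPreorders V G → RightPreorders V G,
      (∀ C : RightPreorders V G,
        ((β C).1 : Set G) = ⋂ t : G, (fun c => t⁻¹ * c * t) '' (C.1 : Set G)) ∧
      -- it is an interior operator, whose open elements are exactly the pre-orders
      IsInteriorOperator β ∧
      Function.fixedPoints β = Preorders V G ∧
      -- and it is a continuous retraction onto the space of pre-orders
      ∃ r : RightPreorders V G → Preorders V G,
        (∀ C, (r C : RightPreorders V G) = β C) ∧
        Continuous r ∧
        ∀ D : Preorders V G, r (D : RightPreorders V G) = D := by
  refine ⟨Preorders.isGeneralisedSpectral V G, RightPreorders.beta hV,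
    fun C => C.1.coe_core_eq_iInter, RightPreorders.isInteriorOperator_beta hV,
    RightPreorders.fixedPoints_beta hV,
    fun C => ⟨RightPreorders.beta hV C, RightPreorders.beta_mem_preorders hV C⟩, fun C => rfl,
    (RightPreorders.continuous_beta hV).subtype_mk _,
    fun D => Subtype.ext (RightPreorders.beta_eq_self hV D.2)⟩
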